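/- Let $k$ be a field, let $1\le d\le n$, let $R=k[\![z_1,\dots,z_n]\!]$ and $S=k[\![z_{d+1},\dots,z_n]\!]$, and let $\Gamma=k_{DP}[Z_1,\dots,Z_n]$ and $Q=k_{DP}[Z_{d+1},\dots,Z_n]\subset\Gamma$ be the spaces of divided power polynomials (DP-polynomials) $\sum_L b_LZ^{[L]}$, on which $R$ and $S$ respectively act by contraction: $z^M\circ Z^{[L]}=Z^{[L-M]}$ if $M\le L$ componentwise, and $0$ otherwise. Write $\gamma_i$ for the $i$-th unit vector of $\mathbb N^d$ and $\mathbb N_+=\{1,2,\dots\}$. An $R$-submodule $M\subset\Gamma$ is called $G_d$-admissible (with respect to $z_1,\dots,z_d$) if it has a system of generators $\{H_L\}_{L\in\mathbb N_+^d}$ such that for all $L=(l_1,\dots,l_d)\in\mathbb N_+^d$ and $i=1,\dots,d$ 1. $z_i\circ H_L=H_{L-\gamma_i}$ if $l_i\ge2$, and $z_i\circ H_L=0$ if $l_i=1$; 2. $\operatorname{Ann}_R(H_L)\circ H_{L+\gamma_i}=\langle H_{L-(l_i-1)\gamma_i}\rangle$. Let $H\in Q$ and let $M=\langle Z_1^{l_1-1}\cdots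 Z_d^{l_d-1}H \mid (l_1,\dots,l_d)\in\mathbb N_+^d\rangle\subset\Gamma$ be the $R$-submodule generated by these elements, where multiplication by $Z_1^{l_1-1}\cdots Z_d^{l_d-1}$ raises exponents as in a polynomial ring: it sends $Z^{[A]}$ to $Z^{[A+(l_1-1,\dots,l_d-1,0,\dots,0)]}$. Then $M$ is $G_d$-admissible with respect to $z_1,\dots,z_d$, and $\operatorname{Ann}_R(M)$ is the cone $\operatorname{Ann}_S(H)R$. If moreover $H\neq0$, then $R/\operatorname{Ann}_R(M)$ is a Gorenstein local ring of dimension $d$. If $H$ is homogeneous, the same holds with $R=k[z_1,\dots,z_n]$ and $S=k[z_{d+1},\dots,z_n]$ the polynomial rings: $M$, now the $k[z_1,\dots,z_n]$-submodule generated by the same elements, is $G_d$-admissible with respect to $z_1,\dots,z_d$, $\operatorname{Ann}_R(M)=\operatorname{Ann}_S(H)R$ is a homogeneous ideal, and, if $H\ne0$, the standard graded $k$-algebra $R/\operatorname{Ann}_R(M)$ is a Gorenstein ring of dimension $d$. -/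

import Mathlib

open IsLocalRing

noncomputable section

attribute [local instance] MvPolynomial.gradedAlgebra

/-! ### Divided power polynomials and contraction -/

/-- DP-polynomials `k_DP[Z_i : i ∈ σ]`, as finitely supported families of coefficients: the
function `Finsupp.single L b` is the term `b Z^[L]`. Only the additive structure and the
contraction action of polynomials and power series are used, never an internal product. -/
def DPPoly (σ k : Type*) [Field k] : Type _ := (σ →₀ ℕ) →₀ k

namespace DPPoly

variable {σ τ k : Type*} [Field k]

instance : AddCommGroup (DPPoly σ k) := inferInstanceAs (AddCommGroup ((σ →₀ ℕ) →₀ k))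

instance : Module k (DPPoly σ k) := inferInstanceAs (Module k ((σ →₀ ℕ) →₀ k))

/-- The term `b Z^[L]`. -/
def term (L : σ →₀ ℕ) (b : k) : DPPoly σ k := Finsupp.single L b

/-- The coefficient of `Z^[L]`. -/
def coeff (L : σ →₀ ℕ) (F : DPPoly σ k) : k := Finsupp.toFun F L

open Classical in
/-- Contraction of `F = ∑_L b_L Z^[L]` by `h = ∑_M a_M z^M`:
`h ∘ F = ∑_L ∑_{M ≤ L} a_M b_L Z^[L - M]`; the pairs `p` below are the pairs `(M, L - M)`. -/
def contract (h : MvPowerSeries σ k) (F : DPPoly σ k) : DPPoly σ k :=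
  Finsupp.sum F fun L b =>
    ∑ p ∈ Finset.HasAntidiagonal.antidiagonal L, term p.2 (MvPowerSeries.coeff p.1 h * b)

theorem term_zero (L : σ →₀ ℕ) : (term L 0 : DPPoly σ k) = 0 := Finsupp.single_zero L

theorem term_add (L : σ →₀ ℕ) (a b : k) : term L (a + b) = term L a + term L b :=
  Finsupp.single_add L a b

theorem induction_term {P : DPPoly σ k → Prop} (F : DPPoly σ k) (h0 : P 0)
    (hadd : ∀ F G, P F → P G → P (F + G)) (hterm : ∀ L b, P (term L b)) : P F :=
  Finsupp.induction_linear F h0 hadd hterm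

open Classical in
theorem contract_term (h : MvPowerSeries σ k) (L : σ →₀ ℕ) (b : k) :
    contract h (term L b) =
      ∑ p ∈ Finset.HasAntidiagonal.antidiagonal L, term p.2 (MvPowerSeries.coeff p.1 h * b) :=
  Finsupp.sum_single_index (by simp [term_zero])

theorem contract_zero (h : MvPowerSeries σ k) : contract h (0 : DPPoly σ k) = 0 :=
  Finsupp.sum_zero_index

theorem contract_add (h : MvPowerSeries σ k) (F G : DPPoly σ k) :
    contract h (F + G) = contract h F + contract h G :=
  Finsupp.sum_add_index' (by simp [term_zero])
    (by intro L a b; simp [mul_add, term_add, Finset.sum_add_distrib])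

theorem add_contract (g h : MvPowerSeries σ k) (F : DPPoly σ k) :
    contract (g + h) F = contract g F + contract h F := by
  induction F using induction_term with
  | h0 => simp [contract_zero]
  | hadd F G hF hG => simp only [contract_add, hF, hG]; abel
  | hterm L b => simp [contract_term, add_mul, term_add, Finset.sum_add_distrib]

theorem zero_contract (F : DPPoly σ k) : contract 0 F = 0 := by
  induction F using induction_term with
  | h0 => simp [contract_zero]
  | hadd F G hF hG => simp only [contract_add, hF, hG, add_zero]
  | hterm L b => simp [contract_term, term_zero]

theorem one_contract (F : DPPoly σ k) : contract 1 F = F := by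
  classical
  induction F using induction_term with
  | h0 => simp [contract_zero]
  | hadd F G hF hG => simp only [contract_add, hF, hG]
  | hterm L b =>
    rw [contract_term, Finset.sum_eq_single ((0, L) : (σ →₀ ℕ) × (σ →₀ ℕ))]
    · simp
    · rintro ⟨M, N⟩ hp hne
      have hM : M ≠ 0 := by
        rintro rfl
        rw [Finset.HasAntidiagonal.mem_antidiagonal] at hp
        simp only [zero_add] at hp
        exact hne (by rw [hp])
      simp [MvPowerSeries.coeff_one, hM, term_zero]
    · simp

theorem contract_sum {ι : Type*} (h : MvPowerSeries σ k) (s : Finset ι) (f : ι → DPPoly σ k) :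
    contract h (∑ i ∈ s, f i) = ∑ i ∈ s, contract h (f i) :=
  map_sum (⟨⟨contract h, contract_zero h⟩, contract_add h⟩ : DPPoly σ k →+ DPPoly σ k) f s

theorem term_sum {ι : Type*} (L : σ →₀ ℕ) (s : Finset ι) (f : ι → k) :
    term L (∑ i ∈ s, f i) = ∑ i ∈ s, term L (f i) :=
  map_sum (⟨⟨term L, term_zero L⟩, term_add L⟩ : k →+ DPPoly σ k) f s

theorem mul_contract (g h : MvPowerSeries σ k) (F : DPPoly σ k) :
    contract (g * h) F = contract g (contract h F) := by
  classical
  induction F using induction_term with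
  | h0 => simp [contract_zero]
  | hadd F G hF hG => simp only [contract_add, hF, hG]
  | hterm L b =>
    simp only [contract_term, contract_sum, MvPowerSeries.coeff_mul, Finset.sum_mul, term_sum,
      Finset.sum_sigma']
    refine Finset.sum_nbij' (fun x => ⟨(x.2.2, x.2.1 + x.1.2), (x.2.1, x.1.2)⟩)
      (fun x => ⟨(x.2.1 + x.1.1, x.2.2), (x.2.1, x.1.1)⟩) ?_ ?_ ?_ ?_ ?_
    · rintro ⟨⟨M, N⟩, ⟨P, Q⟩⟩ hx
      simp only [Finset.mem_sigma, Finset.HasAntidiagonal.mem_antidiagonal] at hx ⊢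
      refine ⟨?_, trivial⟩
      rw [← hx.1, ← hx.2]; abel
    · rintro ⟨⟨M, N⟩, ⟨P, Q⟩⟩ hx
      simp only [Finset.mem_sigma, Finset.HasAntidiagonal.mem_antidiagonal] at hx ⊢
      refine ⟨?_, trivial⟩
      rw [← hx.1, ← hx.2]; abel
    · rintro ⟨⟨M, N⟩, ⟨P, Q⟩⟩ hx
      simp only [Finset.mem_sigma, Finset.HasAntidiagonal.mem_antidiagonal] at hx
      obtain ⟨rfl, rfl⟩ := hx
      rfl
    · rintro ⟨⟨M, N⟩, ⟨P, Q⟩⟩ hx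
      simp only [Finset.mem_sigma, Finset.HasAntidiagonal.mem_antidiagonal] at hx
      obtain ⟨rfl, rfl⟩ := hx
      rfl
    · rintro ⟨⟨M, N⟩, ⟨P, Q⟩⟩ hx
      simp [mul_assoc]

/-- `k_DP[Z]` as a module over the power series ring `k[[z]]`, by contraction. -/
instance : Module (MvPowerSeries σ k) (DPPoly σ k) where
  smul := contract
  one_smul := one_contract
  mul_smul := mul_contract
  smul_zero := contract_zero
  smul_add := contract_add
  add_smul := add_contract
  zero_smul := zero_contract

/-- `k_DP[Z]` as a module over the polynomial ring `k[z]`, by contraction. -/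
instance : Module (MvPolynomial σ k) (DPPoly σ k) :=
  Module.compHom _ (MvPolynomial.coeToMvPowerSeries.ringHom (σ := σ) (R := k))

/-- Multiplication by the monomial with exponent `B` as in a polynomial ring, with the `Z^[L]` in
the role of the monomials: `Z^[L] ↦ Z^[B + L]`. -/
def monomialMul (B : σ →₀ ℕ) (F : DPPoly σ k) : DPPoly σ k :=
  Finsupp.mapDomain (fun L => B + L) F

/-- View a DP-polynomial in the variables `τ` as one in the larger set of variables `σ`. -/
def embed (e : τ ↪ σ) (F : DPPoly τ k) : DPPoly σ k :=
  Finsupp.mapDomain (fun L => Finsupp.embDomain e L) F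

/-- All terms of `F` have total degree `r`. -/
def IsHomogeneous (F : DPPoly σ k) (r : ℕ) : Prop :=
  ∀ L : σ →₀ ℕ, coeff L F ≠ 0 → L.degree = r

end DPPoly

/-! ### `G_d`-admissible submodules -/

section Admissible

variable {R Γ : Type*} [CommRing R] [AddCommGroup Γ] [Module R Γ] {d : ℕ}

/-- `{H_L}`, `L ∈ ℕ₊^d`, is a `G_d`-admissible family with respect to `z_1, …, z_d`. The
multi-indices `L - γ_i`, `L + γ_i` and `L - (l_i - 1) γ_i` arise from `L` by replacing the entry
`l_i` by `l_i - 1`, by `l_i + 1` and by `1`. -/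
structure IsGdAdmissibleFamily (z : Fin d → R) (H : (Fin d → ℕ+) → Γ) : Prop where
  smul_eq : ∀ (L : Fin d → ℕ+) (i : Fin d),
    z i • H L = if 1 < L i then H (Function.update L i (L i - 1)) else 0
  annihilator_smul_eq : ∀ (L : Fin d → ℕ+) (i : Fin d),
    (Submodule.span R {H L}).annihilator •
        Submodule.span R {H (Function.update L i (L i + 1))} =
      Submodule.span R {H (Function.update L i 1)}

/-- The submodule `M` is `G_d`-admissible with respect to `z_1, …, z_d`: it is generated by a
`G_d`-admissible family. -/
def IsGdAdmissible (z : Fin d → R) (M : Submodule R Γ) : Prop :=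
  ∃ H : (Fin d → ℕ+) → Γ, Submodule.span R (Set.range H) = M ∧ IsGdAdmissibleFamily z H

end Admissible

/-! ### Gorenstein rings -/

/-- The type `dim_{B/𝔪} Soc(B)` of a local ring `B` of dimension zero, where
`Soc(B) = 0 :_B 𝔪`. -/
def socleDim (B : Type*) [CommRing B] [IsLocalRing B] : ℕ :=
  Module.finrank (B ⧸ maximalIdeal B)
    (Submodule.torsionBySet B B (maximalIdeal B : Set B))

/-- Artinian Gorenstein local rings: Artinian local rings of type one. -/
def IsArtinianGorensteinLocal (B : Type*) [CommRing B] : Prop :=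
  IsArtinianRing B ∧ ∃ _ : IsLocalRing B, socleDim B = 1

/-- Gorenstein local rings, as Cohen-Macaulay local rings of type one: Noetherian local rings with
a regular sequence in the maximal ideal modulo which the ring is Artinian of type one. -/
def IsGorensteinLocal (A : Type*) [CommRing A] : Prop :=
  IsNoetherianRing A ∧ ∃ _ : IsLocalRing A, ∃ xs : List A,
    (∀ x ∈ xs, x ∈ maximalIdeal A) ∧ RingTheory.Sequence.IsRegular A xs ∧
      IsArtinianGorensteinLocal (A ⧸ Ideal.ofList xs)

/-- Gorenstein rings: Noetherian rings all of whose local rings are Gorenstein. -/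
def IsGorenstein (A : Type*) [CommRing A] : Prop :=
  IsNoetherianRing A ∧
    ∀ (p : Ideal A) [p.IsPrime], IsGorensteinLocal (Localization.AtPrime p)

/-! ### The module attached to a DP-polynomial in the last variables

The variables are indexed by `Fin d ⊕ Fin m`, with `n = d + m`: `Sum.inl` gives the first `d`
variables and `Sum.inr` the last `n - d` ones. -/

section Cone

variable {d m : ℕ} {k : Type*} [Field k]

/-- `H_L = Z_1^{l_1 - 1} ⋯ Z_d^{l_d - 1} H`. -/
def coneGenerator (H : DPPoly (Fin m) k) (L : Fin d → ℕ+) : DPPoly (Fin d ⊕ Fin m) k :=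
  DPPoly.monomialMul (∑ i, Finsupp.single (Sum.inl i) ((L i : ℕ) - 1))
    (DPPoly.embed Function.Embedding.inr H)

/-- `M = ⟨H_L | L ∈ ℕ₊^d⟩` over a ring `R` acting on the DP-polynomials. -/
def coneModule (R : Type*) [CommRing R] (d : ℕ) {m : ℕ}
    [Module R (DPPoly (Fin d ⊕ Fin m) k)] (H : DPPoly (Fin m) k) :
    Submodule R (DPPoly (Fin d ⊕ Fin m) k) :=
  Submodule.span R (Set.range fun L : Fin d → ℕ+ => coneGenerator H L)

/-- An ideal of the polynomial ring is homogeneous for the standard grading. -/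
def IsHomogeneousIdeal {σ : Type*} (I : Ideal (MvPolynomial σ k)) : Prop :=
  I.IsHomogeneous (MvPolynomial.homogeneousSubmodule σ k)

end Cone

end

noncomputable section

attribute [local instance] MvPolynomial.gradedAlgebra

/-! ### Gorenstein local rings -/

section GorensteinLocal

open RingTheory.Sequence
open scoped Pointwise

/-! Split the variables into two groups and expand `f` in `R` as a sum of `z^A f_A`, with `A` an
exponent in the first `d` variables and `f_A` in `S`. For `C ≤ A` the part of `f ∘ (Z^A H)` over
`Z^C` is `f_{A-C} ∘ H`, and all other parts vanish (`coeff_smul_shift`). Everything about `M`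
follows from this formula.

Annihilator: `f` kills every `Z^A H` iff every `f_A` lies in `I = Ann_S(H)`. As `I` is finitely
generated, such series form the extension `IR`, and the quotient is `(S/I)[[z_1, …, z_d]]`, or
`(S/I)[z_1, …, z_d]` in the polynomial case.

Admissibility: if `f` kills `Z^A H`, then in `f ∘ (Z^(A+γ_i) H)` only parts free of `Z_i` survive,
and these form a multiple of the generator with `i`-th exponent zero (`exists_smul_shift_eq`).
Conversely, `z_i^(A_i+1)` kills `Z^A H` and sends `Z^(A+γ_i) H` to that generator.

Gorenstein property: by Macaulay duality `S/I` is Artinian with one-dimensional socle, since `S ∘ H`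
contains the constants and nothing else killed by all variables. A power series variable is regular
with quotient the coefficient ring, which settles the local case. The polynomial case requires every
prime: `IsGorenstein.polynomial` reduces to flat local maps under which the maximal ideal extends to
the maximal ideal, and these preserve regular sequences and type. -/

theorem socleDim_eq_one_iff (B : Type*) [CommRing B] [IsLocalRing B] :
    socleDim B = 1 ↔ ∃ s : B, s ≠ 0 ∧ (∀ a ∈ maximalIdeal B, a * s = 0) ∧
      ∀ x : B, (∀ a ∈ maximalIdeal B, a * x = 0) → ∃ c, x = c * s := by
  let := Ideal.Quotient.field (maximalIdeal B)
  unfold socleDim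
  have key := finrank_eq_one_iff' (K := B ⧸ maximalIdeal B)
    (V := Submodule.torsionBySet B B (maximalIdeal B : Set B))
  refine Iff.trans key ?_
  constructor
  · rintro ⟨⟨s, hs⟩, h0, h⟩
    rw [Submodule.mem_torsionBySet_iff] at hs
    refine ⟨s, fun h => h0 (Subtype.ext h), fun a ha => by simpa using hs ⟨a, ha⟩, fun x hx => ?_⟩
    obtain ⟨c, hc⟩ := h ⟨x, (Submodule.mem_torsionBySet_iff _ _).2 fun a => by
      simpa using hx a.1 a.2⟩
    obtain ⟨c, rfl⟩ := Ideal.Quotient.mk_surjective c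
    exact ⟨c, (congrArg Subtype.val hc).symm⟩
  · rintro ⟨s, h0, hs, h⟩
    refine ⟨⟨s, (Submodule.mem_torsionBySet_iff _ _).2 fun a => by simpa using hs a.1 a.2⟩,
      fun h => h0 (congrArg Subtype.val h), fun ⟨x, hx⟩ => ?_⟩
    rw [Submodule.mem_torsionBySet_iff] at hx
    obtain ⟨c, hc⟩ := h x fun a ha => by simpa using hx ⟨a, ha⟩
    exact ⟨Ideal.Quotient.mk _ c, Subtype.ext hc.symm⟩

theorem ringEquiv_mem_maximalIdeal_iff {A B : Type*} [CommRing A] [CommRing B] [IsLocalRing A]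
    [IsLocalRing B] (e : A ≃+* B) {a : A} : e a ∈ maximalIdeal B ↔ a ∈ maximalIdeal A := by
  simp only [mem_maximalIdeal, mem_nonunits_iff, MulEquiv.isUnit_map]

theorem IsArtinianGorensteinLocal.of_ringEquiv {A B : Type*} [CommRing A] [CommRing B]
    (e : A ≃+* B) (h : IsArtinianGorensteinLocal A) : IsArtinianGorensteinLocal B := by
  obtain ⟨h1, h2, h3⟩ := h
  have hB : IsLocalRing B := e.isLocalRing
  refine ⟨e.surjective.isArtinianRing, hB, ?_⟩
  rw [socleDim_eq_one_iff] at h3 ⊢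
  obtain ⟨s, hs0, hs, h⟩ := h3
  refine ⟨e s, by simpa using hs0, fun b hb => ?_, fun x hx => ?_⟩
  · obtain ⟨a, rfl⟩ := e.surjective b
    rw [← map_mul, hs a ((ringEquiv_mem_maximalIdeal_iff e).1 hb), map_zero]
  · obtain ⟨x, rfl⟩ := e.surjective x
    obtain ⟨c, rfl⟩ := h x fun a ha => by
      have := hx (e a) ((ringEquiv_mem_maximalIdeal_iff e).2 ha)
      rwa [← map_mul, EmbeddingLike.map_eq_zero_iff] at this
    exact ⟨e c, map_mul _ _ _⟩

theorem IsGorensteinLocal.of_ringEquiv {A B : Type*} [CommRing A] [CommRing B]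
    (e : A ≃+* B) (h : IsGorensteinLocal A) : IsGorensteinLocal B := by
  obtain ⟨h1, h2, xs, hm, hreg, hG⟩ := h
  have hB : IsLocalRing B := e.isLocalRing
  refine ⟨isNoetherianRing_of_ringEquiv A e, hB, xs.map e, ?_, ?_, ?_⟩
  · intro x hx
    obtain ⟨a, ha, rfl⟩ := List.mem_map.1 hx
    exact (ringEquiv_mem_maximalIdeal_iff e).2 (hm a ha)
  · refine (AddEquiv.isRegular_congr (e := e.toAddEquiv) ?_).1 hreg
    exact List.forall₂_map_right_iff.mpr <| List.forall₂_same.mpr fun r _ x => by simp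
  · refine hG.of_ringEquiv (Ideal.quotientEquiv _ _ e ?_)
    exact (Ideal.map_ofList (e : A →+* B) xs).symm

theorem IsArtinianGorensteinLocal.isGorensteinLocal {A : Type*} [CommRing A]
    (h : IsArtinianGorensteinLocal A) : IsGorensteinLocal A := by
  have h' := h
  obtain ⟨h1, h2, -⟩ := h
  refine ⟨inferInstance, h2, [], by simp, IsRegular.nil A A, h'.of_ringEquiv ?_⟩
  exact (RingEquiv.quotientBot A).symm.trans (Ideal.quotEquivOfEq (Ideal.ofList_nil).symm)

/-- Lift the regular sequence of the quotient and put `y` in front; the two successive quotients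
agree with the quotient by the longer list. -/
theorem IsGorensteinLocal.of_quotient_span_singleton {A : Type*} [CommRing A] [IsLocalRing A]
    [IsNoetherianRing A] {y : A} (hy : y ∈ maximalIdeal A) (hreg : IsSMulRegular A y)
    (h : IsGorensteinLocal (A ⧸ Ideal.span {y})) : IsGorensteinLocal A := by
  obtain ⟨h1, h2, xs, hm, hxs, hG⟩ := h
  have : IsLocalHom (Ideal.Quotient.mk (Ideal.span {y})) :=
    IsLocalHom.of_surjective _ Ideal.Quotient.mk_surjective
  obtain ⟨ys, rfl⟩ : ∃ ys : List A, ys.map (Ideal.Quotient.mk (Ideal.span {y})) = xs :=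
    List.map_surjective_iff.2 Ideal.Quotient.mk_surjective xs
  have hys : ∀ x ∈ ys, x ∈ maximalIdeal A := fun x hx => by
    have := hm _ (List.mem_map_of_mem hx)
    rwa [mem_maximalIdeal, mem_nonunits_iff, isUnit_map_iff] at this
  have hmem : ∀ x ∈ y :: ys, x ∈ maximalIdeal A := by simpa using ⟨hy, hys⟩
  refine ⟨inferInstance, inferInstance, y :: ys, hmem, ?_, ?_⟩
  · have hw := hxs.toIsWeaklyRegular
    refine IsRegular.of_isWeaklyRegular_of_mem_maximalIdeal A hmem ?_
    rw [isWeaklyRegular_cons_iff]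
    refine ⟨hreg, ?_⟩
    have h3 : Ideal.span {y} = y • (⊤ : Ideal A) := by
      simp [← Submodule.ideal_span_singleton_smul]
    rw [← (Submodule.quotEquivOfEq _ _ h3).isWeaklyRegular_congr]
    exact (isWeaklyRegular_map_algebraMap_iff (A ⧸ Ideal.span {y}) (A ⧸ Ideal.span {y}) ys).1 hw
  · refine hG.of_ringEquiv ?_
    rw [← Ideal.map_ofList, Ideal.ofList_cons]
    exact DoubleQuot.quotQuotEquivQuotSup _ _

theorem isLocalHom_of_map_maximalIdeal_le {A E : Type*} [CommRing A] [CommRing E] [IsLocalRing A]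
    [IsLocalRing E] [Algebra A E]
    (h : (maximalIdeal A).map (algebraMap A E) ≤ maximalIdeal E) :
    IsLocalHom (algebraMap A E) :=
  ((IsLocalRing.local_hom_TFAE (algebraMap A E)).out 0 2).mpr h

/-- The hypothesis `hm` makes the closed fibre a field, so flatness carries a generator of the socle
of `A` to a generator of the socle of `C`. -/
theorem IsArtinianGorensteinLocal.of_flat {A C : Type*} [CommRing A] [CommRing C] [IsLocalRing A]
    [IsLocalRing C] [IsNoetherianRing C] [Algebra A C] [Module.Flat A C]
    (hm : (maximalIdeal A).map (algebraMap A C) = maximalIdeal C)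
    (h : IsArtinianGorensteinLocal A) : IsArtinianGorensteinLocal C := by
  obtain ⟨h1, h2, h3⟩ := h
  have := isLocalHom_of_map_maximalIdeal_le hm.le
  have : Module.FaithfullyFlat A C := Module.FaithfullyFlat.of_flat_of_isLocalHom
  refine ⟨(isArtinianRing_iff_isNilpotent_maximalIdeal C).2 ?_, inferInstance, ?_⟩
  · obtain ⟨n, hn⟩ := (isArtinianRing_iff_isNilpotent_maximalIdeal A).1 h1
    exact ⟨n, by rw [← hm, ← Ideal.map_pow, hn]; exact Ideal.map_bot⟩
  · rw [socleDim_eq_one_iff] at h3 ⊢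
    obtain ⟨s, hs0, hs, h⟩ := h3
    refine ⟨algebraMap A C s, ?_, fun a ha => ?_, fun x hx => ?_⟩
    · rwa [Ne, FaithfulSMul.algebraMap_eq_zero_iff]
    · have : maximalIdeal C ≤ (Ideal.span {algebraMap A C s}).annihilator := by
        rw [← hm, Ideal.map_le_iff_le_comap]
        intro a ha
        rw [Ideal.mem_comap, Submodule.mem_annihilator_span_singleton, smul_eq_mul, ← map_mul,
          hs a ha, map_zero]
      simpa [Submodule.mem_annihilator_span_singleton] using this ha
    · let f : (A ⧸ maximalIdeal A) →ₗ[A] C := Submodule.liftQ _ (LinearMap.toSpanSingleton A C x)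
        fun a ha => by
          rw [LinearMap.mem_ker, LinearMap.toSpanSingleton_apply, Algebra.smul_def]
          exact hx _ (hm ▸ Ideal.mem_map_of_mem _ ha)
      have hf : f (Ideal.Quotient.mk _ 1) = x := by
        change (LinearMap.toSpanSingleton A C x) 1 = x
        simp
      have : IsNoetherianRing A := inferInstance
      have : Module.FinitePresentation A (A ⧸ maximalIdeal A) :=
        Module.finitePresentation_of_finite _ _
      -- A socle element `x` of `C` is a map from the residue field of `A` to `C`. By flatness it
      -- factors through a free module `A^n`, where the image of `1` has all coordinates in the
      -- socle of `A`, hence multiples of `s`.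
      obtain ⟨n, a, b, hab⟩ := Module.Flat.exists_factorization_of_finitePresentation f
      have hsoc (i : Fin n) : ∃ c, a (Ideal.Quotient.mk _ 1) i = c * s := by
        refine h _ fun t ht => ?_
        rw [← smul_eq_mul, ← Finsupp.smul_apply, ← map_smul]
        have : t • (Ideal.Quotient.mk (maximalIdeal A) 1) = 0 := by
          rw [Algebra.smul_def, map_one, mul_one]
          exact Ideal.Quotient.eq_zero_iff_mem.2 ht
        rw [this, map_zero, Finsupp.zero_apply]
      choose c hc using hsoc
      refine ⟨∑ i, c i • b (Finsupp.single i 1), ?_⟩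
      rw [← hf, hab, LinearMap.comp_apply, ← Finsupp.univ_sum_single (a (Ideal.Quotient.mk _ 1)),
        map_sum, Finset.sum_mul]
      refine Finset.sum_congr rfl fun i _ => ?_
      rw [hc, ← mul_one (c i * s), ← smul_eq_mul (c i * s), ← Finsupp.smul_single, map_smul,
        Algebra.smul_def, Algebra.smul_def, map_mul]
      ring

theorem Module.Flat.quotient_map {A E : Type*} [CommRing A] [CommRing E] [Algebra A E]
    [Module.Flat A E] (I : Ideal A) :
    Module.Flat (A ⧸ I) (E ⧸ I.map (algebraMap A E)) := by
  exact Module.Flat.of_linearEquiv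
    (Algebra.TensorProduct.quotIdealMapEquivQuotTensor E I).toLinearEquiv

theorem maximalIdeal_quotient {A : Type*} [CommRing A] [IsLocalRing A] (I : Ideal A)
    [IsLocalRing (A ⧸ I)] :
    (maximalIdeal A).map (Ideal.Quotient.mk I) = maximalIdeal (A ⧸ I) := by
  have : IsLocalHom (Ideal.Quotient.mk I) :=
    IsLocalHom.of_surjective _ Ideal.Quotient.mk_surjective
  have h := ((IsLocalRing.local_hom_TFAE (Ideal.Quotient.mk I)).out 0 4).1 this
  rw [← h,
    Ideal.map_comap_of_surjective _ Ideal.Quotient.mk_surjective]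

/-- Faithful flatness preserves the regular sequence, and the induced map of Artinian quotients is
again flat with maximal ideal extending to maximal ideal. -/
theorem IsGorensteinLocal.of_flat {A E : Type*} [CommRing A] [CommRing E] [IsLocalRing A]
    [IsLocalRing E] [IsNoetherianRing E] [Algebra A E] [Module.Flat A E]
    (hm : (maximalIdeal A).map (algebraMap A E) = maximalIdeal E)
    (h : IsGorensteinLocal A) : IsGorensteinLocal E := by
  obtain ⟨h1, h2, xs, hmem, hreg, hG⟩ := h
  have := isLocalHom_of_map_maximalIdeal_le hm.le
  have : Module.FaithfullyFlat A E := Module.FaithfullyFlat.of_flat_of_isLocalHom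
  have hreg' : IsRegular E (xs.map (algebraMap A E)) := hreg.of_faithfullyFlat
  have hmem' : ∀ x ∈ xs.map (algebraMap A E), x ∈ maximalIdeal E := by
    intro x hx
    obtain ⟨a, ha, rfl⟩ := List.mem_map.1 hx
    exact hm ▸ Ideal.mem_map_of_mem _ (hmem a ha)
  refine ⟨inferInstance, inferInstance, xs.map (algebraMap A E), hmem', hreg', ?_⟩
  have hne : Ideal.ofList (xs.map (algebraMap A E)) ≠ ⊤ := fun h =>
    hreg'.top_ne_smul (by rw [h, Submodule.top_smul])
  rw [← Ideal.map_ofList] at hne ⊢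
  set I := Ideal.ofList xs
  have : Nontrivial (E ⧸ I.map (algebraMap A E)) := Ideal.Quotient.nontrivial_iff.2 hne
  have hA : IsLocalRing (A ⧸ I) := hG.2.1
  have hE : IsLocalRing (E ⧸ I.map (algebraMap A E)) :=
    .of_surjective' _ Ideal.Quotient.mk_surjective
  have := Module.Flat.quotient_map (E := E) I
  refine hG.of_flat ?_
  rw [← maximalIdeal_quotient, ← maximalIdeal_quotient, ← hm, Ideal.map_map, Ideal.map_map]
  rfl

theorem IsGorensteinLocal.powerSeries {A : Type*} [CommRing A] (h : IsGorensteinLocal A) :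
    IsGorensteinLocal (PowerSeries A) ∧
      ringKrullDim (PowerSeries A) = ringKrullDim A + 1 := by
  have h' := h
  obtain ⟨h1, h2, -⟩ := h
  have hX : (PowerSeries.X : PowerSeries A) ∈ maximalIdeal (PowerSeries A) := by
    rw [mem_maximalIdeal, mem_nonunits_iff]
    intro hu
    simpa using PowerSeries.isUnit_constantCoeff _ hu
  have hreg : IsSMulRegular (PowerSeries A) (PowerSeries.X : PowerSeries A) := fun f g hfg =>
    PowerSeries.X_mul_inj.1 hfg
  have h3 : Ideal.span {(PowerSeries.X : PowerSeries A)} =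
      RingHom.ker (PowerSeries.constantCoeff (R := A)) := by
    ext f
    rw [Ideal.mem_span_singleton, PowerSeries.X_dvd_iff, RingHom.mem_ker]
  let e : (PowerSeries A ⧸ Ideal.span {(PowerSeries.X : PowerSeries A)}) ≃+* A :=
    (Ideal.quotEquivOfEq h3).trans
      (RingHom.quotientKerEquivOfSurjective PowerSeries.constantCoeff_surj)
  exact ⟨.of_quotient_span_singleton hX hreg (h'.of_ringEquiv e.symm), by
    rw [← ringKrullDim_quotient_span_singleton_succ_eq_ringKrullDim hreg hX,
      ringKrullDim_eq_of_ringEquiv e]⟩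

theorem IsGorensteinLocal.mvPowerSeries_fin {A : Type*} [CommRing A] (h : IsGorensteinLocal A)
    (d : ℕ) : IsGorensteinLocal (MvPowerSeries (Fin d) A) ∧
      ringKrullDim (MvPowerSeries (Fin d) A) = ringKrullDim A + d := by
  induction d with
  | zero =>
    let e : MvPowerSeries (Fin 0) A ≃+* A := (MvPowerSeries.isEmptyEquiv (Fin 0) A).toRingEquiv
    exact ⟨h.of_ringEquiv e.symm, by simp [ringKrullDim_eq_of_ringEquiv e]⟩
  | succ d ih =>
    let e := (MvPowerSeries.finSuccEquiv A d).toRingEquiv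
    obtain ⟨h1, h2⟩ := ih.1.powerSeries
    exact ⟨h1.of_ringEquiv e.symm, by
      rw [ringKrullDim_eq_of_ringEquiv e, h2, ih.2]; push_cast; rw [add_assoc]⟩

end GorensteinLocal

/-! ### Gorenstein rings and polynomial extensions -/

section Gorenstein

open Polynomial

theorem IsGorenstein.of_ringEquiv {A B : Type*} [CommRing A] [CommRing B]
    (e : A ≃+* B) (h : IsGorenstein A) : IsGorenstein B := by
  have := h.1
  refine ⟨isNoetherianRing_of_ringEquiv A e, fun p hp => ?_⟩
  let q := p.comap (e : A →+* B)
  refine (h.2 q).of_ringEquiv (Localization.localRingEquiv q p e rfl)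

theorem IsArtinianGorensteinLocal.isGorenstein {A : Type*} [CommRing A]
    (h : IsArtinianGorensteinLocal A) : IsGorenstein A := by
  have h' := h
  obtain ⟨h1, h2, -⟩ := h
  refine ⟨inferInstance, fun p hp => ?_⟩
  have hpm : p = maximalIdeal A := eq_maximalIdeal (IsArtinianRing.isMaximal_of_isPrime p)
  have hu : p.primeCompl ≤ IsUnit.submonoid A := fun x hx => by
    by_contra hn
    exact hx (hpm ▸ (mem_maximalIdeal x).2 hn)
  exact (h'.isGorensteinLocal).of_ringEquiv
    (IsLocalization.atUnits A p.primeCompl (S := Localization.AtPrime p) hu).toRingEquiv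

/-- Modulo the maximal ideal of `A`, the prime `p` lives in a principal ideal domain, so it is zero
there or generated by a monic polynomial. -/
theorem IsGorensteinLocal.localization_atPrime_polynomial {A : Type*} [CommRing A] [IsLocalRing A]
    (h : IsGorensteinLocal A) (p : Ideal A[X]) [p.IsPrime]
    (hp : p.comap C = maximalIdeal A) : IsGorensteinLocal (Localization.AtPrime p) := by
  have := h.1
  let E := Localization.AtPrime p
  have : Module.Flat A[X] E := IsLocalization.flat E p.primeCompl
  have hE : p.map (algebraMap A[X] E) = maximalIdeal E := Localization.AtPrime.map_eq_maximalIdeal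
  by_cases hq : p = (p.comap C).map C
  -- Here `p` is extended from `A`, so the maximal ideal of `A` generates that of `E`.
  · have : Module.Flat A E := Module.Flat.trans A A[X] E
    refine IsGorensteinLocal.of_flat ?_ h
    rw [IsScalarTower.algebraMap_eq A A[X] E, ← Ideal.map_map, ← hE]
    congr 1
    rw [hq, hp]
    rfl
  -- Here `p` needs one more generator, a monic `F`. It is regular on `E`, and modulo `F` the
  -- situation becomes flat over `A` with field fibre.
  · have hmax : (p.comap C).IsMaximal := hp ▸ maximalIdeal.isMaximal A
    obtain ⟨F, hF, hpF⟩ := Polynomial.exists_monic_span_sup_map_eq A p hmax hq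
    rw [hp] at hpF
    have hFp : F ∈ p := hpF ▸ Ideal.mem_sup_right (Ideal.mem_span_singleton_self F)
    have hFE : algebraMap A[X] E F ∈ maximalIdeal E := hE ▸ Ideal.mem_map_of_mem _ hFp
    have hreg : IsSMulRegular E (algebraMap A[X] E F) := by
      have h1 : IsSMulRegular A[X] F := fun a b hab => hF.isRegular.left hab
      exact h1.of_flat
    refine IsGorensteinLocal.of_quotient_span_singleton hFE hreg ?_
    rw [← Set.image_singleton, ← Ideal.map_span]
    set I := Ideal.span {F}
    let D := A[X] ⧸ I
    let E' := E ⧸ I.map (algebraMap A[X] E)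
    have hI : I.map (algebraMap A[X] E) ≤ maximalIdeal E := by
      rw [Ideal.map_span, Set.image_singleton, Ideal.span_singleton_le_iff_mem]
      exact hFE
    have : Nontrivial E' :=
      Ideal.Quotient.nontrivial_iff.2 fun h => (maximalIdeal.isMaximal E).ne_top
        (top_le_iff.1 (h ▸ hI))
    have : IsLocalRing E' := .of_surjective' _ Ideal.Quotient.mk_surjective
    have : Module.Free A D := hF.free_quotient
    -- `E'` is a localization of `D = A[X]/(F)`, which is free over `A` because `F` is monic.
    have : Module.Flat D E' :=
      IsLocalization.flat E' (Algebra.algebraMapSubmonoid D p.primeCompl)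
    have : IsScalarTower A D E' :=
      IsScalarTower.of_algebraMap_eq (R := A) (S := D) (A := E') fun x => rfl
    have : Module.Flat A E' := Module.Flat.trans A D E'
    refine IsGorensteinLocal.of_flat (E := E') ?_ h
    have hE2 : maximalIdeal E =
        ((maximalIdeal A).map C).map (algebraMap A[X] E) ⊔ I.map (algebraMap A[X] E) := by
      rw [← Ideal.map_sup, ← hpF, hE]
    rw [← maximalIdeal_quotient, hE2, Ideal.map_sup, Ideal.map_map, Ideal.map_map,
      Ideal.map_quotient_self, sup_bot_eq]
    rfl

/-- Localizing the coefficients first at `q = p ∩ A` does not change the local ring at `p`, so the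
coefficient ring may be taken local with `p` lying over its maximal ideal. -/
theorem IsGorenstein.polynomial {A : Type*} [CommRing A] (h : IsGorenstein A) :
    IsGorenstein A[X] := by
  have := h.1
  refine ⟨inferInstance, fun p hp => ?_⟩
  let q := p.comap C
  let S := (Localization.AtPrime q)[X]
  let pc := Submonoid.map Polynomial.C.toMonoidHom q.primeCompl
  let : Algebra A[X] S := algebra A (Localization.AtPrime q)
  have : IsLocalization pc S := Polynomial.isLocalization _ _
  let pS := p.map (algebraMap A[X] S)
  have disj : Disjoint (pc : Set A[X]) (p : Set A[X]) := by
    simpa [pc, q] using! Set.disjoint_image_left.mpr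
      (Set.disjoint_compl_left_iff_subset.mpr (fun _ a ↦ a))
  have : pS.IsPrime := IsLocalization.isPrime_of_isPrime_disjoint pc _ _ ‹_› disj
  have : IsLocalization.AtPrime (Localization.AtPrime pS) p := by
    convert IsLocalization.isLocalization_isLocalization_atPrime_isLocalization pc
      (Localization.AtPrime pS) pS
    exact (IsLocalization.under_map_of_isPrime_disjoint pc _ ‹_› disj).symm
  have eq : pS.comap C = maximalIdeal (Localization.AtPrime q) := by
    -- Ideals of a localization are determined by their contractions to `A`; both sides contract to
    -- `q`.
    rw [← IsLocalization.map_under q.primeCompl _ (pS.comap C),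
      ← IsLocalization.map_under q.primeCompl _ (maximalIdeal (Localization.AtPrime q))]
    simp only [Ideal.comap_comap, S, pS]
    rw [← Polynomial.algebraMap_eq (R := Localization.AtPrime q),
      ← IsScalarTower.algebraMap_eq A (Localization.AtPrime q) (Localization.AtPrime q)[X],
      IsScalarTower.algebraMap_eq A A[X] (Localization.AtPrime q)[X], ← Ideal.comap_comap,
      ← Ideal.under_def A[X], IsLocalization.under_map_of_isPrime_disjoint pc _ ‹_› disj]
    simp [q, IsLocalization.AtPrime.under_maximalIdeal (Localization.AtPrime q) q]
  exact ((h.2 q).localization_atPrime_polynomial pS eq).of_ringEquiv (IsLocalization.algEquiv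
    p.primeCompl (Localization.AtPrime pS) (Localization.AtPrime p)).toRingEquiv

theorem IsGorenstein.mvPolynomial {A : Type*} [CommRing A] (h : IsGorenstein A) (ι : Type*)
    [Finite ι] : IsGorenstein (MvPolynomial ι A) := by
  induction ι using Finite.induction_empty_option with
  | of_equiv e H => exact H.of_ringEquiv (MvPolynomial.renameEquiv _ e).toRingEquiv
  | h_empty => exact h.of_ringEquiv (MvPolynomial.isEmptyRingEquiv A _).symm
  | h_option IH =>
    exact IH.polynomial.of_ringEquiv (MvPolynomial.optionEquivLeft _ _).toRingEquiv.symm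

end Gorenstein

/-! ### Coefficients of contractions -/

namespace DPPoly

variable {σ τ k : Type*} [Field k]

@[ext]
theorem ext {F G : DPPoly σ k} (h : ∀ N, coeff N F = coeff N G) : F = G :=
  Finsupp.ext h

@[simp]
theorem coeff_zero (N : σ →₀ ℕ) : coeff N (0 : DPPoly σ k) = 0 := rfl

@[simp]
theorem coeff_add (N : σ →₀ ℕ) (F G : DPPoly σ k) : coeff N (F + G) = coeff N F + coeff N G := rfl

open Classical in
theorem coeff_term (N L : σ →₀ ℕ) (b : k) : coeff N (term L b) = if N = L then b else 0 := by
  simp_rw [eq_comm (a := N)]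
  exact Finsupp.single_apply

theorem coeff_sum {ι : Type*} (N : σ →₀ ℕ) (s : Finset ι) (f : ι → DPPoly σ k) :
    coeff N (∑ i ∈ s, f i) = ∑ i ∈ s, coeff N (f i) :=
  map_sum (⟨⟨coeff N, coeff_zero N⟩, coeff_add N⟩ : DPPoly σ k →+ k) f s

open Classical in
theorem coeff_smul_term (N L : σ →₀ ℕ) (f : MvPowerSeries σ k) (b : k) :
    coeff N (f • term L b) = if N ≤ L then MvPowerSeries.coeff (L - N) f * b else 0 := by
  change coeff N (contract f (term L b)) = _
  rw [contract_term, coeff_sum]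
  simp_rw [coeff_term]
  split_ifs with h
  · rw [Finset.sum_eq_single (L - N, N)]
    · simp
    · rintro ⟨P, Q⟩ hp hne
      rw [Finset.HasAntidiagonal.mem_antidiagonal] at hp
      rw [if_neg]
      rintro rfl
      exact hne (by rw [← hp]; simp)
    · intro hn
      exact absurd (Finset.HasAntidiagonal.mem_antidiagonal.2 (tsub_add_cancel_of_le h)) hn
  · refine Finset.sum_eq_zero fun p hp => if_neg ?_
    rintro rfl
    exact h (Finset.HasAntidiagonal.mem_antidiagonal.1 hp ▸ le_add_self)

theorem coeff_monomial_smul (N M : σ →₀ ℕ) (F : DPPoly σ k) :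
    coeff N ((MvPowerSeries.monomial M 1 : MvPowerSeries σ k) • F) = coeff (M + N) F := by
  classical
  induction F using induction_term with
  | h0 => simp
  | hadd F G hF hG => rw [smul_add, coeff_add, hF, hG, coeff_add]
  | hterm L b =>
    rw [coeff_smul_term, coeff_term, MvPowerSeries.coeff_monomial]
    by_cases h : N ≤ L
    · simp [h, tsub_eq_iff_eq_add_of_le h, eq_comm (a := L)]
    · rw [if_neg h, if_neg]
      rintro rfl
      exact h le_add_self

theorem coeff_C_smul (N : σ →₀ ℕ) (a : k) (F : DPPoly σ k) :
    coeff N ((MvPowerSeries.C a : MvPowerSeries σ k) • F) = a * coeff N F := by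
  classical
  induction F using induction_term with
  | h0 => simp
  | hadd F G hF hG => rw [smul_add, coeff_add, hF, hG, coeff_add, mul_add]
  | hterm L b =>
    rw [coeff_smul_term, coeff_term, MvPowerSeries.coeff_C]
    by_cases h : N ≤ L
    · have h' : L - N = 0 ↔ N = L := by
        rw [tsub_eq_zero_iff_le]
        exact ⟨fun h' => h.antisymm h', fun h' => h'.ge⟩
      simp [h, h']
    · rw [if_neg h, if_neg, mul_zero]
      rintro rfl
      exact h le_rfl

/-- A DP-polynomial has finitely many terms, so it only sees coefficients of bounded degree; a power
series may therefore be replaced by a truncation. -/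
theorem exists_degree_smul_congr (F : DPPoly σ k) : ∃ n : ℕ, ∀ f g : MvPowerSeries σ k,
    (∀ M : σ →₀ ℕ, M.degree < n → MvPowerSeries.coeff M f = MvPowerSeries.coeff M g) →
      f • F = g • F := by
  classical
  induction F using induction_term with
  | h0 => exact ⟨0, fun f g _ => by simp⟩
  | hadd F G hF hG =>
    obtain ⟨m, hm⟩ := hF
    obtain ⟨n, hn⟩ := hG
    refine ⟨max m n, fun f g h => ?_⟩
    rw [smul_add, smul_add, hm f g fun M hM => h M (lt_max_of_lt_left hM),
      hn f g fun M hM => h M (lt_max_of_lt_right hM)]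
  | hterm L b =>
    refine ⟨L.degree + 1, fun f g h => ?_⟩
    ext N
    rw [coeff_smul_term, coeff_smul_term, h (L - N)]
    exact Nat.lt_succ_of_le (Finsupp.degree_mono tsub_le_self)

theorem polynomial_smul_eq (p : MvPolynomial σ k) (F : DPPoly σ k) :
    p • F = (p : MvPowerSeries σ k) • F := rfl

theorem exists_polynomial_smul_eq [Finite σ] (f : MvPowerSeries σ k) (F : DPPoly σ k) :
    ∃ p : MvPolynomial σ k, p • F = f • F := by
  obtain ⟨n, hn⟩ := exists_degree_smul_congr F
  refine ⟨MvPowerSeries.truncTotal n f, ?_⟩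
  rw [polynomial_smul_eq]
  refine hn _ _ fun M hM => ?_
  rw [MvPolynomial.coeff_coe, MvPowerSeries.coeff_truncTotal _ hM]

/-- The element `Z^A F`, for `F` in the variables `τ` and `A` an exponent in the variables `σ`. -/
def shift (A : σ →₀ ℕ) (F : DPPoly τ k) : DPPoly (σ ⊕ τ) k :=
  monomialMul (A.sumElim 0) (embed Function.Embedding.inr F)

theorem shift_zero (A : σ →₀ ℕ) : shift A (0 : DPPoly τ k) = 0 := by
  unfold shift embed
  erw [Finsupp.mapDomain_zero]
  exact Finsupp.mapDomain_zero

theorem shift_add (A : σ →₀ ℕ) (F G : DPPoly τ k) : shift A (F + G) = shift A F + shift A G := by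
  unfold shift embed
  erw [Finsupp.mapDomain_add]
  exact Finsupp.mapDomain_add

theorem shift_term (A : σ →₀ ℕ) (L : τ →₀ ℕ) (b : k) :
    shift A (term L b) = term (A.sumElim L) b := by
  simp only [shift, embed, monomialMul, term]
  erw [Finsupp.mapDomain_single, Finsupp.mapDomain_single]
  congr 1
  ext (i | i)
  · simp only [Finsupp.add_apply, Finsupp.sumElim_inl]
    rw [Finsupp.embDomain_of_notMem_range _ _ _ (by simp), add_zero]
  · simp only [Finsupp.add_apply, Finsupp.sumElim_inr, Finsupp.zero_apply, zero_add]
    exact Finsupp.embDomain_apply_self Function.Embedding.inr L i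

end DPPoly

/-! ### Exponents in two groups of variables -/

theorem Finsupp.sumElim_le_sumElim {σ τ : Type*} {A C : σ →₀ ℕ} {L N : τ →₀ ℕ} :
    C.sumElim N ≤ A.sumElim L ↔ C ≤ A ∧ N ≤ L := by
  simp [Finsupp.le_def]

theorem Finsupp.sumElim_tsub_sumElim {σ τ : Type*} (A C : σ →₀ ℕ) (L N : τ →₀ ℕ) :
    A.sumElim L - C.sumElim N = (A - C).sumElim (L - N) := by
  ext (i | i) <;> simp

theorem Finsupp.exists_eq_sumElim {σ τ : Type*} (P : σ ⊕ τ →₀ ℕ) :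
    ∃ (C : σ →₀ ℕ) (N : τ →₀ ℕ), P = C.sumElim N :=
  ⟨_, _, (Finsupp.comapDomain_sumElim_comapDomain P).symm⟩

theorem Finsupp.sumElim_inj {σ τ : Type*} {A C : σ →₀ ℕ} {L N : τ →₀ ℕ} :
    C.sumElim N = A.sumElim L ↔ C = A ∧ N = L := by
  simp [Finsupp.ext_iff]

/-! ### Power series in two groups of variables -/

namespace MvPowerSeries

variable {σ τ k : Type*} [CommRing k]

/-- The coefficients of a power series in the variables `σ ⊕ τ` with respect to the monomials in
the variables `σ`. -/
def slices (f : MvPowerSeries (σ ⊕ τ) k) : MvPowerSeries σ (MvPowerSeries τ k) :=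
  fun A N => coeff (A.sumElim N) f

theorem coeff_coeff_slices (f : MvPowerSeries (σ ⊕ τ) k) (A : σ →₀ ℕ) (N : τ →₀ ℕ) :
    coeff N (coeff A (slices f)) = coeff (A.sumElim N) f := rfl

/-- Power series in the variables `σ ⊕ τ` as power series in the variables `σ` whose coefficients
are power series in the variables `τ`. -/
def sumRingEquiv : MvPowerSeries (σ ⊕ τ) k ≃+* MvPowerSeries σ (MvPowerSeries τ k) where
  toFun := slices
  invFun g := fun P => coeff (P.comapDomain Sum.inr Sum.inr_injective.injOn)
    (coeff (P.comapDomain Sum.inl Sum.inl_injective.injOn) g)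
  left_inv f := by
    ext P
    change coeff (Finsupp.sumElim _ _) f = coeff P f
    rw [Finsupp.comapDomain_sumElim_comapDomain]
  right_inv g := by
    ext A N
    change coeff (Finsupp.comapDomain _ (A.sumElim N) _)
      (coeff (Finsupp.comapDomain _ (A.sumElim N) _) g) = coeff N (coeff A g)
    rw [Finsupp.comapDomain_inl_sumElim, Finsupp.comapDomain_inr_sumElim]
  map_add' f g := rfl
  map_mul' f g := by
    classical
    ext A N
    rw [coeff_coeff_slices, coeff_mul, coeff_mul, map_sum]
    simp_rw [coeff_mul, coeff_coeff_slices]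
    rw [← Finset.sum_product', ← Finsupp.image_sumElim_product_antidiagonal, Finset.sum_image]
    · rintro ⟨⟨a, b⟩, ⟨c, d⟩⟩ - ⟨⟨a', b'⟩, ⟨c', d'⟩⟩ - h
      simp only [Prod.mk.injEq, Finsupp.sumElim_inj] at h ⊢
      tauto

theorem coeff_coeff_sumRingEquiv (f : MvPowerSeries (σ ⊕ τ) k) (A : σ →₀ ℕ) (N : τ →₀ ℕ) :
    coeff N (coeff A (sumRingEquiv f)) = coeff (A.sumElim N) f := rfl

theorem sumRingEquiv_rename_inr [Finite τ] (g : MvPowerSeries τ k) :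
    sumRingEquiv (rename (Sum.inr : τ → σ ⊕ τ) g) = C g := by
  classical
  ext A N
  rw [coeff_coeff_sumRingEquiv, coeff_C]
  split_ifs with h
  · subst h
    have : (0 : σ →₀ ℕ).sumElim N = N.embDomain Function.Embedding.inr := by
      ext (i | i)
      · rw [Finsupp.sumElim_inl, Finsupp.embDomain_of_notMem_range _ _ _ (by simp)]; rfl
      · rw [Finsupp.sumElim_inr]
        exact (Finsupp.embDomain_apply_self Function.Embedding.inr N i).symm
    rw [this]
    exact coeff_embDomain_rename Function.Embedding.inr g N
  · rw [map_zero]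
    refine coeff_rename_eq_zero _ _ ?_
    rintro ⟨x, hx⟩
    refine h (Finsupp.ext fun i => ?_)
    have := DFunLike.congr_fun hx (Sum.inl i)
    rw [Finsupp.sumElim_inl, Finsupp.mapDomain_of_notMem_range _ _ (by simp)] at this
    exact this.symm

/-- The kernel consists of the series whose slices all lie in `I`. Finite generation is essential:
infinitely many slices must be expressed through the same finite set of generators. -/
theorem map_rename_inr_eq [Finite τ] (I : Ideal (MvPowerSeries τ k)) (hI : I.FG) :
    I.map (rename (Sum.inr : τ → σ ⊕ τ)) = RingHom.ker
      ((map (Ideal.Quotient.mk I)).comp (sumRingEquiv (σ := σ) (τ := τ) (k := k)).toRingHom) := by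
  classical
  apply le_antisymm
  · rw [Ideal.map_le_iff_le_comap]
    intro g hg
    rw [Ideal.mem_comap, RingHom.mem_ker, RingHom.comp_apply]
    change map (Ideal.Quotient.mk I) (sumRingEquiv (rename Sum.inr g)) = 0
    rw [sumRingEquiv_rename_inr, map_C, Ideal.Quotient.eq_zero_iff_mem.2 hg, map_zero]
  · intro f hf
    have hf (A : σ →₀ ℕ) : coeff A (sumRingEquiv f) ∈ I := by
      have := congrArg (coeff A) hf
      rw [← Ideal.Quotient.eq_zero_iff_mem, ← coeff_map]
      exact this
    obtain ⟨s, rfl⟩ := hI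
    choose c hc using fun A => (Submodule.mem_span_finset'.1 (hf A))
    -- For each generator, its coefficients in all the slices are collected into one power series.
    let q (g : s) : MvPowerSeries σ (MvPowerSeries τ k) := fun A => c A g
    have : f = ∑ g : s, rename (Sum.inr : τ → σ ⊕ τ) g.1 * sumRingEquiv.symm (q g) := by
      apply sumRingEquiv.injective
      rw [map_sum]
      ext A : 1
      rw [map_sum, ← hc A]
      refine Finset.sum_congr rfl fun g _ => ?_
      rw [map_mul, sumRingEquiv_rename_inr, RingEquiv.apply_symm_apply, coeff_C_mul, smul_eq_mul,
        mul_comm]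
      rfl
    rw [this]
    exact Ideal.sum_mem _ fun g _ => Ideal.mul_mem_right _ _
      (Ideal.mem_map_of_mem _ (Ideal.subset_span g.2))

end MvPowerSeries

/-! ### Contraction of the elements `Z^A F` -/

namespace DPPoly

variable {σ τ k : Type*} [Field k]

open Classical in
theorem coeff_smul_shift (f : MvPowerSeries (σ ⊕ τ) k) (A C : σ →₀ ℕ) (N : τ →₀ ℕ)
    (F : DPPoly τ k) :
    coeff (C.sumElim N) (f • shift A F) =
      if C ≤ A then coeff N (MvPowerSeries.coeff (A - C) (MvPowerSeries.sumRingEquiv f) • F)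
      else 0 := by
  induction F using induction_term with
  | h0 => simp [shift_zero]
  | hadd F G hF hG =>
    rw [shift_add, smul_add, coeff_add, hF, hG, smul_add, coeff_add]
    split_ifs <;> simp
  | hterm L b =>
    rw [shift_term, coeff_smul_term, coeff_smul_term, Finsupp.sumElim_tsub_sumElim,
      MvPowerSeries.coeff_coeff_sumRingEquiv]
    simp only [Finsupp.sumElim_le_sumElim, ite_and]

/-- Each part of `f ∘ (Z^A F)` involves a single slice of `f`, and the part over `Z^0` is slice `A`
itself applied to `F`. -/
theorem forall_smul_shift_eq_zero_iff (f : MvPowerSeries (σ ⊕ τ) k) (F : DPPoly τ k) :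
    (∀ A : σ →₀ ℕ, f • shift A F = 0) ↔
      ∀ A, MvPowerSeries.coeff A (MvPowerSeries.sumRingEquiv f) • F = 0 := by
  classical
  constructor
  · intro h A
    ext N
    have := congrArg (coeff ((0 : σ →₀ ℕ).sumElim N)) (h A)
    rwa [coeff_smul_shift, if_pos (zero_le), tsub_zero] at this
  · intro h A
    ext P
    obtain ⟨C, N, rfl⟩ := Finsupp.exists_eq_sumElim P
    rw [coeff_smul_shift, h]
    split_ifs <;> rfl

theorem X_pow_smul_shift (i : σ) (n : ℕ) (A : σ →₀ ℕ) (F : DPPoly τ k) :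
    (MvPowerSeries.X (Sum.inl i) ^ n : MvPowerSeries (σ ⊕ τ) k) • shift A F =
      if n ≤ A i then shift (A - Finsupp.single i n) F else 0 := by
  classical
  ext P
  obtain ⟨C, N, rfl⟩ := Finsupp.exists_eq_sumElim P
  -- Inserting the factor `1` lets `coeff_smul_shift` compute the coefficients of `shift A F`
  -- itself.
  rw [MvPowerSeries.X_pow_eq, coeff_monomial_smul, ← one_smul (MvPowerSeries (σ ⊕ τ) k) (shift A F)]
  have h1 : Finsupp.single (Sum.inl i) n + C.sumElim N =
      (Finsupp.single i n + C).sumElim N := by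
    ext (j | j) <;> simp [Finsupp.single_apply]
  rw [h1, coeff_smul_shift]
  split_ifs with h2 h3 h3
  · rw [← one_smul (MvPowerSeries (σ ⊕ τ) k) (shift _ F), coeff_smul_shift, if_pos,
      tsub_add_eq_tsub_tsub]
    exact (le_tsub_iff_left (Finsupp.single_le_iff.2 h3)).2 h2
  · exact absurd (by simpa using le_trans (Nat.le_add_right _ _) (h2 i)) h3
  · rw [← one_smul (MvPowerSeries (σ ⊕ τ) k) (shift _ F), coeff_smul_shift, if_neg]
    exact fun h => h2 ((le_tsub_iff_left (Finsupp.single_le_iff.2 h3)).1 h)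
  · rfl

/-- This is the nontrivial inclusion in the second admissibility condition. -/
theorem exists_smul_shift_eq (f : MvPowerSeries (σ ⊕ τ) k) (A : σ →₀ ℕ) (i : σ) (F : DPPoly τ k)
    (hf : f • shift A F = 0) : ∃ g : MvPowerSeries (σ ⊕ τ) k,
      f • shift (A + Finsupp.single i 1) F = g • shift (A.erase i) F := by
  classical
  -- For `C i = 0` the slice of `f` acting has `i`-th index `A i + 1`, whereas on `A.erase i` that
  -- index is `0`; hence the slices of `g` are those of `f` moved by `A i + 1` in direction `i`.
  let h : MvPowerSeries σ (MvPowerSeries τ k) := fun B =>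
    MvPowerSeries.coeff (B + Finsupp.single i (A i + 1)) (MvPowerSeries.sumRingEquiv f)
  let g : MvPowerSeries (σ ⊕ τ) k := MvPowerSeries.sumRingEquiv.symm h
  have hg (B : σ →₀ ℕ) : MvPowerSeries.coeff B (MvPowerSeries.sumRingEquiv g) =
      MvPowerSeries.coeff (B + Finsupp.single i (A i + 1)) (MvPowerSeries.sumRingEquiv f) := by
    rw [show MvPowerSeries.sumRingEquiv g = h from RingEquiv.apply_symm_apply _ _]
    rfl
  refine ⟨g, ?_⟩
  ext P
  obtain ⟨C, N, rfl⟩ := Finsupp.exists_eq_sumElim P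
  rw [coeff_smul_shift, coeff_smul_shift, hg]
  by_cases hC : C i = 0
  · have h1 : C ≤ A + Finsupp.single i 1 ↔ C ≤ A.erase i := by
      simp only [Finsupp.le_def]
      refine forall_congr' fun j => ?_
      by_cases hj : j = i
      · subst hj; simp [hC]
      · simp [hj]
    have h2 : A + Finsupp.single i 1 - C = A.erase i - C + Finsupp.single i (A i + 1) := by
      ext j
      by_cases hj : j = i
      · subst hj; simp [hC]
      · simp [hj]
    simp only [h1, h2]
  -- For `C i > 0`, lowering both `A + γ_i` and `C` by `γ_i` keeps the slice, so this is a
  -- coefficient of `f • shift A F = 0`.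
  · rw [if_neg (c := C ≤ A.erase i) fun h => hC (by simpa using h i)]
    split_ifs with h
    · have hCi : Finsupp.single i 1 ≤ C := Finsupp.single_le_iff.2 (Nat.one_le_iff_ne_zero.2 hC)
      have h3 : C - Finsupp.single i 1 ≤ A := tsub_le_iff_right.2 h
      have := congrArg (coeff ((C - Finsupp.single i 1).sumElim N)) hf
      rw [coeff_smul_shift, if_pos h3] at this
      have h4 : A + Finsupp.single i 1 - C = A - (C - Finsupp.single i 1) := by
        ext j
        have h5 := hCi j
        simp only [Finsupp.tsub_apply, Finsupp.add_apply] at h5 ⊢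
        omega
      rw [h4]
      exact this
    · rfl

end DPPoly

/-! ### Quotients by annihilators of DP-polynomials -/

namespace DPPoly

variable {σ k : Type*} [Field k]

/-- Contraction by a monomial whose exponent has maximal degree in the support of `F` leaves only a
constant. -/
theorem exists_smul_eq_term_zero {F : DPPoly σ k} (hF : F ≠ 0) :
    ∃ (s : MvPowerSeries σ k) (c : k), c ≠ 0 ∧ s • F = term 0 c := by
  classical
  have hne : (Finsupp.support (α := σ →₀ ℕ) (M := k) F).Nonempty :=
    Finsupp.support_nonempty_iff.2 hF
  obtain ⟨L, hL, hmax⟩ := Finset.exists_max_image _ Finsupp.degree hne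
  refine ⟨MvPowerSeries.monomial L 1, coeff L F, Finsupp.mem_support_iff.1 hL, ?_⟩
  ext N
  rw [coeff_monomial_smul, coeff_term]
  split_ifs with h
  · rw [h, add_zero]
  · by_contra hc
    have := hmax (L + N) (Finsupp.mem_support_iff.2 hc)
    rw [map_add, add_le_iff_nonpos_right, nonpos_iff_eq_zero, Finsupp.degree_eq_zero_iff] at this
    exact h this

theorem eq_term_zero_of_forall_X_smul_eq_zero {G : DPPoly σ k}
    (hG : ∀ i, (MvPowerSeries.X i : MvPowerSeries σ k) • G = 0) : G = term 0 (coeff 0 G) := by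
  classical
  ext N
  rw [coeff_term]
  split_ifs with h
  · rw [h]
  · obtain ⟨i, hi⟩ := Finsupp.ne_iff.1 h
    have h1 := congrArg (coeff (N - Finsupp.single i 1)) (hG i)
    rw [MvPowerSeries.X, coeff_monomial_smul, add_tsub_cancel_of_le] at h1
    · exact h1
    · exact Finsupp.single_le_iff.2 (Nat.one_le_iff_ne_zero.2 hi)

theorem smul_term_zero (f : MvPowerSeries σ k) (c : k) :
    f • (term 0 c : DPPoly σ k) = term 0 (MvPowerSeries.constantCoeff f * c) := by
  classical
  ext N
  rw [coeff_smul_term, coeff_term]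
  by_cases h : N = 0
  · subst h
    simp
  · rw [if_neg h, if_neg]
    exact fun h' => h (le_antisymm h' zero_le)

/-- All `f ∘ F` are supported on the finitely many exponents below the support of `F`, so the
quotient embeds in a finite power of `k`. -/
theorem finite_quotient_annihilator (F : DPPoly σ k) :
    Module.Finite k
      (MvPowerSeries σ k ⧸ (Submodule.span (MvPowerSeries σ k) {F}).annihilator) := by
  classical
  let s : Finset (σ →₀ ℕ) := (Finsupp.support (α := σ →₀ ℕ) (M := k) F).biUnion fun L =>
    (Finset.HasAntidiagonal.antidiagonal L).image Prod.snd
  have hs (f : MvPowerSeries σ k) (N : σ →₀ ℕ) (hN : N ∉ s) : coeff N (f • F) = 0 := by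
    change coeff N (contract f F) = 0
    unfold contract Finsupp.sum
    rw [coeff_sum]
    refine Finset.sum_eq_zero fun L hL => ?_
    rw [coeff_sum]
    refine Finset.sum_eq_zero fun p hp => ?_
    rw [coeff_term, if_neg]
    rintro rfl
    exact hN (Finset.mem_biUnion.2 ⟨L, hL, Finset.mem_image_of_mem _ hp⟩)
  let T : MvPowerSeries σ k →ₗ[k] (s → k) :=
    { toFun := fun f N => coeff N.1 (f • F)
      map_add' := fun f g => by
        ext N
        rw [add_smul, coeff_add, Pi.add_apply]
      map_smul' := fun a f => by
        ext N
        rw [MvPowerSeries.smul_eq_C_mul, mul_smul, coeff_C_smul]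
        rfl }
  have hT : LinearMap.ker T =
      (Submodule.span (MvPowerSeries σ k) {F}).annihilator.restrictScalars k := by
    ext f
    rw [LinearMap.mem_ker, Submodule.restrictScalars_mem,
      Submodule.mem_annihilator_span_singleton]
    constructor
    · intro h
      ext N
      by_cases hN : N ∈ s
      · exact congrFun h ⟨N, hN⟩
      · exact hs f N hN
    · intro h
      ext N
      change coeff N.1 (f • F) = 0
      rw [h, coeff_zero]
  have h1 : Module.Finite k (MvPowerSeries σ k ⧸ LinearMap.ker T) :=
    Module.Finite.equiv T.quotKerEquivRange.symm
  rw [hT] at h1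
  exact Module.Finite.equiv (Submodule.Quotient.restrictScalarsEquiv k
    (Submodule.span (MvPowerSeries σ k) {F}).annihilator)

/-- The quotient is isomorphic to the cyclic module `R ∘ F`, whose socle consists of the elements
killed by all variables: exactly the constants. -/
theorem isArtinianGorensteinLocal_quotient_annihilator {F : DPPoly σ k} (hF : F ≠ 0) :
    IsArtinianGorensteinLocal
      (MvPowerSeries σ k ⧸ (Submodule.span (MvPowerSeries σ k) {F}).annihilator) := by
  set I := (Submodule.span (MvPowerSeries σ k) {F}).annihilator
  have hI (f : MvPowerSeries σ k) : Ideal.Quotient.mk I f = 0 ↔ f • F = 0 := by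
    rw [Ideal.Quotient.eq_zero_iff_mem, Submodule.mem_annihilator_span_singleton]
  have : Module.Finite k (MvPowerSeries σ k ⧸ I) := finite_quotient_annihilator F
  have : Nontrivial (MvPowerSeries σ k ⧸ I) := by
    refine ⟨1, 0, fun h => hF ?_⟩
    rw [← map_one (Ideal.Quotient.mk I), hI, one_smul] at h
    exact h
  have hloc : IsLocalRing (MvPowerSeries σ k ⧸ I) :=
    .of_surjective' _ Ideal.Quotient.mk_surjective
  refine ⟨IsArtinianRing.of_finite k _, hloc, ?_⟩
  have hmax (f : MvPowerSeries σ k) : Ideal.Quotient.mk I f ∈ maximalIdeal _ ↔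
      MvPowerSeries.constantCoeff f = 0 := by
    have : IsLocalHom (Ideal.Quotient.mk I) :=
      IsLocalHom.of_surjective _ Ideal.Quotient.mk_surjective
    rw [mem_maximalIdeal, mem_nonunits_iff, isUnit_map_iff, MvPowerSeries.isUnit_iff_constantCoeff,
      isUnit_iff_ne_zero, not_not]
  rw [socleDim_eq_one_iff]
  obtain ⟨s, c, hc, hs⟩ := exists_smul_eq_term_zero hF
  refine ⟨Ideal.Quotient.mk I s, fun h => hc ?_, fun a ha => ?_, fun x hx => ?_⟩
  · rw [hI, hs] at h
    simpa [coeff_term] using congrArg (coeff 0) h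
  · obtain ⟨a, rfl⟩ := Ideal.Quotient.mk_surjective a
    rw [hmax] at ha
    rw [← map_mul, hI, mul_smul, hs, smul_term_zero, ha, zero_mul, term_zero]
  · obtain ⟨f, rfl⟩ := Ideal.Quotient.mk_surjective x
    have h1 : f • F = term 0 (coeff 0 (f • F)) :=
      eq_term_zero_of_forall_X_smul_eq_zero fun i => by
        rw [← mul_smul, ← hI, map_mul]
        exact hx _ ((hmax _).2 (MvPowerSeries.constantCoeff_X i))
    refine ⟨Ideal.Quotient.mk I (MvPowerSeries.C (coeff 0 (f • F) / c)), ?_⟩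
    rw [← map_mul, ← sub_eq_zero, ← map_sub, hI, sub_smul, mul_smul, hs, smul_term_zero,
      MvPowerSeries.constantCoeff_C, div_mul_cancel₀ _ hc, ← h1, sub_self]

/-- Polynomials and power series have the same quotient by the annihilator of a DP-polynomial. -/
def quotientAnnihilatorEquiv [Finite σ] (F : DPPoly σ k) :
    (MvPolynomial σ k ⧸ (Submodule.span (MvPolynomial σ k) {F}).annihilator) ≃+*
      (MvPowerSeries σ k ⧸ (Submodule.span (MvPowerSeries σ k) {F}).annihilator) :=
  let f : MvPolynomial σ k →+* _ := (Ideal.Quotient.mk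
    (Submodule.span (MvPowerSeries σ k) {F}).annihilator).comp
      MvPolynomial.coeToMvPowerSeries.ringHom
  have hf : Function.Surjective f := fun x => by
    obtain ⟨x, rfl⟩ := Ideal.Quotient.mk_surjective x
    obtain ⟨p, hp⟩ := exists_polynomial_smul_eq x F
    refine ⟨p, Ideal.Quotient.eq.2 ?_⟩
    rw [Submodule.mem_annihilator_span_singleton, sub_smul, ← hp]
    exact sub_self _
  have hker : (Submodule.span (MvPolynomial σ k) {F}).annihilator = RingHom.ker f := by
    ext p
    rw [RingHom.mem_ker, RingHom.comp_apply, Ideal.Quotient.eq_zero_iff_mem,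
      Submodule.mem_annihilator_span_singleton, Submodule.mem_annihilator_span_singleton]
    rfl
  (Ideal.quotEquivOfEq hker).trans (RingHom.quotientKerEquivOfSurjective hf)

/-- For `F` homogeneous of degree `r`, the coefficient of `Z^[N]` in `p ∘ F` only involves the
component of `p` of degree `r - |N|`. -/
theorem homogeneousComponent_smul_eq_zero {F : DPPoly σ k} {r : ℕ} (hF : F.IsHomogeneous r)
    {p : MvPolynomial σ k} (hp : p • F = 0) (j : ℕ) :
    MvPolynomial.homogeneousComponent j p • F = 0 := by
  classical
  have key (q : MvPolynomial σ k) (N : σ →₀ ℕ) : coeff N (q • F) =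
      ∑ L ∈ (Finsupp.support (α := σ →₀ ℕ) (M := k) F),
        if N ≤ L then MvPolynomial.coeff (L - N) q * coeff L F else 0 := by
    have hF : F = ∑ L ∈ (Finsupp.support (α := σ →₀ ℕ) (M := k) F), term L (coeff L F) :=
      (Finsupp.sum_single (M := k) F).symm
    conv_lhs => rw [hF, Finset.smul_sum, coeff_sum]
    refine Finset.sum_congr rfl fun L _ => ?_
    rw [polynomial_smul_eq, coeff_smul_term, MvPolynomial.coeff_coe]
  ext N
  rw [key]
  by_cases h : N.degree + j = r
  · have h0 := congrArg (coeff N) hp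
    rw [key] at h0
    refine Eq.trans (Finset.sum_congr rfl fun L hL => ?_) h0
    have hL' := hF L (Finsupp.mem_support_iff.1 hL)
    split_ifs with hN
    · rw [MvPolynomial.coeff_homogeneousComponent, if_pos]
      have := congrArg Finsupp.degree (tsub_add_cancel_of_le hN)
      rw [map_add] at this
      omega
    · rfl
  · refine Finset.sum_eq_zero fun L hL => ?_
    have hL' := hF L (Finsupp.mem_support_iff.1 hL)
    split_ifs with hN
    · rw [MvPolynomial.coeff_homogeneousComponent, if_neg, zero_mul]
      have := congrArg Finsupp.degree (tsub_add_cancel_of_le hN)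
      rw [map_add] at this
      omega
    · rfl

theorem coeff_shift {τ : Type*} (A C : σ →₀ ℕ) (N : τ →₀ ℕ) (F : DPPoly τ k) [Decidable (C = A)] :
    coeff (C.sumElim N) (shift A F) = if C = A then coeff N F else 0 := by
  classical
  induction F using induction_term with
  | h0 => simp [shift_zero]
  | hadd F G hF hG =>
    rw [shift_add, coeff_add, hF, hG]
    split_ifs <;> simp
  | hterm L b =>
    rw [shift_term, coeff_term, coeff_term]
    simp only [Finsupp.sumElim_inj, ite_and]

theorem IsHomogeneous.shift {τ : Type*} {F : DPPoly τ k} {r : ℕ} (hF : F.IsHomogeneous r)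
    (A : σ →₀ ℕ) : (DPPoly.shift A F).IsHomogeneous (A.degree + r) := by
  classical
  intro P hP
  obtain ⟨C, N, rfl⟩ := Finsupp.exists_eq_sumElim P
  rw [coeff_shift] at hP
  split_ifs at hP with h
  · rw [h, Finsupp.sumElim_eq_add, map_add, Finsupp.degree_mapDomain,
      Finsupp.degree_mapDomain, hF N hP]
  · exact absurd rfl hP

end DPPoly

/-! ### The module attached to a DP-polynomial in the last variables -/

section Cone

variable {d m : ℕ} {k : Type*} [Field k]

/-- The exponent `(l_1 - 1, …, l_d - 1)`. -/
def predExponent (L : Fin d → ℕ+) : Fin d →₀ ℕ :=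
  Finsupp.equivFunOnFinite.symm fun i => (L i : ℕ) - 1

theorem predExponent_apply (L : Fin d → ℕ+) (i : Fin d) : predExponent L i = (L i : ℕ) - 1 := rfl

theorem predExponent_surjective : Function.Surjective (predExponent (d := d)) := fun A =>
  ⟨fun i => (A i).succPNat, by ext i; simp [predExponent_apply]⟩

theorem predExponent_update_add_one (L : Fin d → ℕ+) (i : Fin d) :
    predExponent (Function.update L i (L i + 1)) = predExponent L + Finsupp.single i 1 := by
  ext j
  have := (L i).pos
  by_cases hj : j = i
  · subst hj
    simp [predExponent_apply]
    omega
  · simp [predExponent_apply, hj]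

theorem predExponent_update_one (L : Fin d → ℕ+) (i : Fin d) :
    predExponent (Function.update L i 1) = (predExponent L).erase i := by
  ext j
  by_cases hj : j = i
  · subst hj
    simp [predExponent_apply]
  · simp [predExponent_apply, hj]

theorem predExponent_update_sub_one (L : Fin d → ℕ+) (i : Fin d) (h : 1 < L i) :
    predExponent (Function.update L i (L i - 1)) = predExponent L - Finsupp.single i 1 := by
  ext j
  by_cases hj : j = i
  · subst hj
    simp [predExponent_apply, PNat.sub_coe, h]
  · simp [predExponent_apply, hj]

theorem coneGenerator_eq_shift (H : DPPoly (Fin m) k) (L : Fin d → ℕ+) :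
    coneGenerator H L = DPPoly.shift (predExponent L) H := by
  unfold coneGenerator DPPoly.shift
  congr 1
  ext (j | j)
  · rw [Finsupp.finsetSum_apply, Finset.sum_eq_single j]
    · simp [predExponent_apply]
    · intro b _ hb
      rw [Finsupp.single_apply, if_neg (by simpa using hb)]
    · simp
  · simp

variable {R : Type*} [CommRing R] [Module R (DPPoly (Fin d ⊕ Fin m) k)]
  {ψ : R →+* MvPowerSeries (Fin d ⊕ Fin m) k}

/-- The map `ψ` treats polynomials and power series together; `hsurj` turns the power series
produced by `exists_smul_shift_eq` back into an element of `R`. -/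
theorem isGdAdmissible_coneModule
    (hψ : ∀ (r : R) (F : DPPoly (Fin d ⊕ Fin m) k), r • F = ψ r • F)
    (hsurj : ∀ (f : MvPowerSeries (Fin d ⊕ Fin m) k) (F : DPPoly (Fin d ⊕ Fin m) k),
      ∃ r : R, r • F = f • F)
    {z : Fin d → R} (hz : ∀ i, ψ (z i) = MvPowerSeries.X (Sum.inl i)) (H : DPPoly (Fin m) k) :
    IsGdAdmissible z (coneModule R d H) := by
  refine ⟨fun L => coneGenerator H L, rfl, fun L i => ?_, fun L i => ?_⟩
  · simp only [coneGenerator_eq_shift]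
    rw [hψ, hz, ← pow_one (MvPowerSeries.X _), DPPoly.X_pow_smul_shift, predExponent_apply]
    by_cases h : 1 < L i
    · have h' : 1 < (L i : ℕ) := h
      rw [if_pos h, if_pos (by omega), predExponent_update_sub_one L i h]
    · have h' : ¬ 1 < (L i : ℕ) := h
      rw [if_neg h, if_neg (by omega)]
  · simp only [coneGenerator_eq_shift, predExponent_update_add_one, predExponent_update_one]
    apply le_antisymm
    · rw [Submodule.smul_le]
      intro r hr x hx
      obtain ⟨c, rfl⟩ := Submodule.mem_span_singleton.1 hx
      rw [Submodule.mem_annihilator_span_singleton, hψ] at hr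
      rw [smul_comm]
      refine Submodule.smul_mem _ c (Submodule.mem_span_singleton.2 ?_)
      obtain ⟨g, hg⟩ := DPPoly.exists_smul_shift_eq (ψ r) _ i H hr
      obtain ⟨t, ht⟩ := hsurj g (DPPoly.shift ((predExponent L).erase i) H)
      exact ⟨t, by rw [ht, hψ, hg]⟩
    · rw [Submodule.span_singleton_le_iff_mem]
      -- This power is one too large for `H_L`, hence annihilates it, and exactly removes `Z_i` from
      -- the next generator.
      have h1 : (z i ^ (predExponent L i + 1)) •
          DPPoly.shift (predExponent L + Finsupp.single i 1) H =
            DPPoly.shift ((predExponent L).erase i) H := by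
        rw [hψ, map_pow, hz, DPPoly.X_pow_smul_shift, if_pos (by simp)]
        congr 1
        ext j
        by_cases hj : j = i
        · subst hj; simp
        · simp [hj]
      rw [← h1]
      refine Submodule.smul_mem_smul ?_ (Submodule.mem_span_singleton_self _)
      rw [Submodule.mem_annihilator_span_singleton, hψ, map_pow, hz, DPPoly.X_pow_smul_shift,
        if_neg (by simp)]

theorem mem_annihilator_coneModule
    (hψ : ∀ (r : R) (F : DPPoly (Fin d ⊕ Fin m) k), r • F = ψ r • F)
    (H : DPPoly (Fin m) k) (r : R) : r ∈ (coneModule R d H).annihilator ↔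
      ∀ A, MvPowerSeries.coeff A (MvPowerSeries.sumRingEquiv (ψ r)) • H = 0 := by
  rw [← DPPoly.forall_smul_shift_eq_zero_iff, coneModule, Submodule.mem_annihilator_span]
  simp only [Subtype.forall, Set.forall_mem_range, coneGenerator_eq_shift, hψ]
  exact (predExponent_surjective.forall (p := fun A => ψ r • DPPoly.shift A H = 0)).symm

theorem isHomogeneousIdeal_annihilator_coneModule {H : DPPoly (Fin m) k} {r : ℕ}
    (hH : H.IsHomogeneous r) :
    IsHomogeneousIdeal (coneModule (MvPolynomial (Fin d ⊕ Fin m) k) d H).annihilator := by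
  intro j p hp
  have hdec : (DirectSum.decompose (MvPolynomial.homogeneousSubmodule (Fin d ⊕ Fin m) k) p j :
      MvPolynomial (Fin d ⊕ Fin m) k) = MvPolynomial.homogeneousComponent j p :=
    MvPolynomial.decomposition.decompose'_apply p j
  rw [hdec]
  rw [coneModule, Submodule.mem_annihilator_span] at hp ⊢
  simp only [Subtype.forall, Set.forall_mem_range, coneGenerator_eq_shift] at hp ⊢
  exact fun L => DPPoly.homogeneousComponent_smul_eq_zero (hH.shift _) (hp L) j

end Cone

/-! ### The cone ideal and its quotient ring -/

theorem IsArtinianGorensteinLocal.ringKrullDim_eq_zero {A : Type*} [CommRing A]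
    (h : IsArtinianGorensteinLocal A) : ringKrullDim A = 0 := by
  obtain ⟨h1, h2, -⟩ := h
  exact ringKrullDimZero_iff_ringKrullDim_eq_zero.1 inferInstance

theorem MvPolynomial.sumAlgEquiv_monomial_sumElim {σ τ k : Type*} [CommRing k] (A : σ →₀ ℕ)
    (N : τ →₀ ℕ) (a : k) :
    sumAlgEquiv k σ τ (monomial (A.sumElim N) a) = monomial A (monomial N a) := by
  simp [sumAlgEquiv, monomial]

/-- Polynomial and power series slices agree, so `mem_annihilator_coneModule` also applies to
polynomials. -/
theorem MvPolynomial.coeff_coeff_sumAlgEquiv {σ τ k : Type*} [CommRing k]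
    (p : MvPolynomial (σ ⊕ τ) k) (A : σ →₀ ℕ) :
    ((coeff A (sumAlgEquiv k σ τ p) : MvPolynomial τ k) : MvPowerSeries τ k) =
      MvPowerSeries.coeff A (MvPowerSeries.sumRingEquiv (p : MvPowerSeries (σ ⊕ τ) k)) := by
  classical
  ext N
  rw [MvPowerSeries.coeff_coeff_sumRingEquiv, coeff_coe, coeff_coe]
  induction p using MvPolynomial.induction_on' with
  | monomial P a =>
    obtain ⟨C, M, rfl⟩ := Finsupp.exists_eq_sumElim P
    rw [sumAlgEquiv_monomial_sumElim, coeff_monomial, coeff_monomial]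
    simp only [Finsupp.sumElim_inj]
    split_ifs <;> simp_all
  | add p q hp hq => rw [map_add, coeff_add, coeff_add, hp, hq, coeff_add]

theorem MvPowerSeries.map_surjective_of_surjective {σ A B : Type*} [CommRing A] [CommRing B]
    {f : A →+* B} (hf : Function.Surjective f) :
    Function.Surjective (MvPowerSeries.map (σ := σ) f) := fun g => by
  choose q hq using fun N => hf (MvPowerSeries.coeff N g)
  let q' : MvPowerSeries σ A := q
  exact ⟨q', MvPowerSeries.ext fun N => (MvPowerSeries.coeff_map f N q').trans (hq N)⟩

/-- In kernel form the quotient is visibly the power series ring over `S/I`. -/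
theorem annihilator_coneModule_mvPowerSeries {d m : ℕ} {k : Type*} [Field k]
    (H : DPPoly (Fin m) k) :
    (coneModule (MvPowerSeries (Fin d ⊕ Fin m) k) d H).annihilator = RingHom.ker
      ((MvPowerSeries.map (Ideal.Quotient.mk
        (Submodule.span (MvPowerSeries (Fin m) k) {H}).annihilator)).comp
          (MvPowerSeries.sumRingEquiv (σ := Fin d) (τ := Fin m) (k := k)).toRingHom) := by
  ext f
  rw [mem_annihilator_coneModule (ψ := RingHom.id _) (fun _ _ => rfl), RingHom.mem_ker,
    MvPowerSeries.ext_iff]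
  refine forall_congr' fun A => ?_
  rw [← Submodule.mem_annihilator_span_singleton, ← Ideal.Quotient.eq_zero_iff_mem]
  rfl

theorem annihilator_coneModule_mvPolynomial {d m : ℕ} {k : Type*} [Field k]
    (H : DPPoly (Fin m) k) :
    (coneModule (MvPolynomial (Fin d ⊕ Fin m) k) d H).annihilator =
      ((Submodule.span (MvPolynomial (Fin m) k) {H}).annihilator.map MvPolynomial.C).comap
        (MvPolynomial.sumAlgEquiv k (Fin d) (Fin m)) := by
  ext p
  rw [mem_annihilator_coneModule (ψ := MvPolynomial.coeToMvPowerSeries.ringHom) (fun _ _ => rfl),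
    Ideal.mem_comap, MvPolynomial.mem_map_C_iff]
  refine forall_congr' fun A => ?_
  rw [Submodule.mem_annihilator_span_singleton, DPPoly.polynomial_smul_eq,
    MvPolynomial.coeff_coeff_sumAlgEquiv]
  rfl

theorem map_rename_inr_eq_comap_sumAlgEquiv {σ τ k : Type*} [CommRing k]
    (I : Ideal (MvPolynomial τ k)) :
    I.map (MvPolynomial.rename (Sum.inr : τ → σ ⊕ τ)) =
      (I.map MvPolynomial.C).comap (MvPolynomial.sumAlgEquiv k σ τ) := by
  have h : (I.map (MvPolynomial.rename (R := k) (Sum.inr : τ → σ ⊕ τ))).map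
      (MvPolynomial.sumAlgEquiv k σ τ) = I.map MvPolynomial.C := by
    change Ideal.map (MvPolynomial.sumAlgEquiv k σ τ).toAlgHom _ = _
    rw [Ideal.map_mapₐ, MvPolynomial.sumAlgEquiv_comp_rename_inr]
    rfl
  rw [← h, Ideal.comap_map_of_bijective _ (MvPolynomial.sumAlgEquiv k σ τ).bijective]

end

theorem proposition4p1 {k : Type*} [Field k] (d m : ℕ) (hd : 0 < d) (H : DPPoly (Fin m) k) :
    -- the local case: `R = k[[z_1, …, z_n]]`, `S = k[[z_{d+1}, …, z_n]]`
    (IsGdAdmissible (fun i : Fin d => (MvPowerSeries.X (Sum.inl i) :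
          MvPowerSeries (Fin d ⊕ Fin m) k))
        (coneModule (MvPowerSeries (Fin d ⊕ Fin m) k) d H) ∧
      (coneModule (MvPowerSeries (Fin d ⊕ Fin m) k) d H).annihilator =
        (Submodule.span (MvPowerSeries (Fin m) k) {H}).annihilator.map
          (MvPowerSeries.rename (Sum.inr : Fin m → Fin d ⊕ Fin m)) ∧
      (H ≠ 0 →
        IsGorensteinLocal (MvPowerSeries (Fin d ⊕ Fin m) k ⧸
          (coneModule (MvPowerSeries (Fin d ⊕ Fin m) k) d H).annihilator) ∧
        ringKrullDim (MvPowerSeries (Fin d ⊕ Fin m) k ⧸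
          (coneModule (MvPowerSeries (Fin d ⊕ Fin m) k) d H).annihilator) = d)) ∧
    -- the graded case: `H` homogeneous, `R = k[z_1, …, z_n]`, `S = k[z_{d+1}, …, z_n]`
    (∀ r : ℕ, H.IsHomogeneous r →
      IsGdAdmissible (fun i : Fin d => (MvPolynomial.X (Sum.inl i) :
          MvPolynomial (Fin d ⊕ Fin m) k))
        (coneModule (MvPolynomial (Fin d ⊕ Fin m) k) d H) ∧
      (coneModule (MvPolynomial (Fin d ⊕ Fin m) k) d H).annihilator =
        (Submodule.span (MvPolynomial (Fin m) k) {H}).annihilator.map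
          (MvPolynomial.rename (Sum.inr : Fin m → Fin d ⊕ Fin m)) ∧
      IsHomogeneousIdeal (coneModule (MvPolynomial (Fin d ⊕ Fin m) k) d H).annihilator ∧
      (H ≠ 0 →
        IsGorenstein (MvPolynomial (Fin d ⊕ Fin m) k ⧸
          (coneModule (MvPolynomial (Fin d ⊕ Fin m) k) d H).annihilator) ∧
        ringKrullDim (MvPolynomial (Fin d ⊕ Fin m) k ⧸
          (coneModule (MvPolynomial (Fin d ⊕ Fin m) k) d H).annihilator) = d)) := by
  refine ⟨⟨?_, ?_, fun hH => ?_⟩, fun r hr => ⟨?_, ?_, ?_, fun hH => ?_⟩⟩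
  · exact isGdAdmissible_coneModule (ψ := RingHom.id _) (fun _ _ => rfl) (fun f F => ⟨f, rfl⟩)
      (fun _ => rfl) H
  · rw [annihilator_coneModule_mvPowerSeries]
    exact (MvPowerSeries.map_rename_inr_eq _ (IsNoetherian.noetherian _)).symm
  · rw [annihilator_coneModule_mvPowerSeries]
    have hB := DPPoly.isArtinianGorensteinLocal_quotient_annihilator hH
    obtain ⟨h1, h2⟩ := hB.isGorensteinLocal.mvPowerSeries_fin d
    let e := RingHom.quotientKerEquivOfSurjective
      (f := (MvPowerSeries.map (Ideal.Quotient.mk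
        (Submodule.span (MvPowerSeries (Fin m) k) {H}).annihilator)).comp
          (MvPowerSeries.sumRingEquiv (σ := Fin d) (τ := Fin m) (k := k)).toRingHom)
      ((MvPowerSeries.map_surjective_of_surjective Ideal.Quotient.mk_surjective).comp
        MvPowerSeries.sumRingEquiv.surjective)
    exact ⟨h1.of_ringEquiv e.symm, by
      rw [ringKrullDim_eq_of_ringEquiv e, h2, hB.ringKrullDim_eq_zero, zero_add]⟩
  · exact isGdAdmissible_coneModule (ψ := MvPolynomial.coeToMvPowerSeries.ringHom)
      (fun _ _ => rfl) DPPoly.exists_polynomial_smul_eq (fun _ => MvPolynomial.coe_X _) H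
  · rw [annihilator_coneModule_mvPolynomial, map_rename_inr_eq_comap_sumAlgEquiv]
  · exact isHomogeneousIdeal_annihilator_coneModule hr
  · rw [annihilator_coneModule_mvPolynomial]
    -- The polynomial quotient `S/I` coincides with the power series one, so it is already local
    -- Artinian Gorenstein.
    have hB := (DPPoly.isArtinianGorensteinLocal_quotient_annihilator hH).of_ringEquiv
      (DPPoly.quotientAnnihilatorEquiv H).symm
    have := hB.1
    let I := (Submodule.span (MvPolynomial (Fin m) k) {H}).annihilator
    -- The composite identifies the quotient by the cone with `(S/I)[z_1, …, z_d]`.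
    let e := (Ideal.quotientEquiv ((I.map MvPolynomial.C).comap
      (MvPolynomial.sumAlgEquiv k (Fin d) (Fin m))) (I.map MvPolynomial.C)
        (MvPolynomial.sumAlgEquiv k (Fin d) (Fin m)).toRingEquiv
        (Ideal.map_comap_of_surjective _
          (MvPolynomial.sumAlgEquiv k (Fin d) (Fin m)).surjective _).symm).trans
      (MvPolynomial.quotientEquivQuotientMvPolynomial (σ := Fin d) I).toRingEquiv.symm
    exact ⟨(hB.isGorenstein.mvPolynomial (Fin d)).of_ringEquiv e.symm, by
      rw [ringKrullDim_eq_of_ringEquiv e, MvPolynomial.ringKrullDim_of_isNoetherianRing,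
        hB.ringKrullDim_eq_zero, zero_add, Nat.card_fin]⟩
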